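/- Let $q$ be a prime power, let $1 \le k \le m$ be integers, and let $\mathcal{C} \subseteq \mathrm{Mat}(k\times m, \mathbb{F}_q)$ be a non-zero Delsarte code, i.e. a non-zero $\mathbb{F}_q$-linear subspace, of dimension $t$. Put $\mathrm{minrk}(\mathcal{C}) := \min\{\mathrm{rk}(M) : M \in \mathcal{C},\ \mathrm{rk}(M)>0\}$. For a subspace $\mathcal{A} \subseteq \mathrm{Mat}(k\times m,\mathbb{F}_q)$ put $\mathrm{maxrk}(\mathcal{A}) := \max\{\mathrm{rk}(M) : M \in \mathcal{A}\}$, and call $\mathcal{A}$ an optimal anticode if $\dim_{\mathbb{F}_q}(\mathcal{A}) = m\cdot \mathrm{maxrk}(\mathcal{A})$. For $1 \le r \le t$ let the $r$-th Delsarte generalized weight of $\mathcal{C}$ be $$a_r(\mathcal{C}) := \frac1m \min\{\dim_{\mathbb{F}_q}(\mathcal{A}) : \mathcal{A} \subseteq \mathrm{Mat}(k\times m,\mathbb{F}_q) \text{ an optimal anticode},\ \dim_{\mathbb{F}_q}(\mathcal{A}\cap\mathcal{C}) \ge r\}.$$ Then the following hold. 1. $a_1(\mathcal{C}) = \mathrm{minrk}(\mathcal{C})$.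 2. $a_t(\mathcal{C}) \le k$. 3. For any $1 \le r \le t-1$ we have $a_r(\mathcal{C}) \le a_{r+1}(\mathcal{C})$. 4. For any $1 \le r \le t-m$ we have $a_r(\mathcal{C}) < a_{r+m}(\mathcal{C})$. 5. For any $1 \le r \le t$ we have $a_r(\mathcal{C}) \le k - \lfloor (t-r)/m \rfloor$. 6. For any $1 \le r \le t$ we have $a_r(\mathcal{C}) \ge \lceil r/m \rceil$. -/

import Mathlib

/-- A Delsarte (rank-metric) code of size `k × m` over `F`: an `F`-linear subspace of the space of
`k × m` matrices over `F`. -/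
abbrev DelsarteCode (F : Type*) [Field F] (k m : ℕ) : Type _ :=
  Submodule F (Matrix (Fin k) (Fin m) F)

namespace DelsarteCode

variable {F : Type*} [Field F] {k m : ℕ}

/-- The minimum rank of a (non-zero) code: the least positive rank of its elements. -/
noncomputable def minRank (C : DelsarteCode F k m) : ℕ :=
  sInf {d : ℕ | ∃ M ∈ C, 0 < M.rank ∧ M.rank = d}

/-- The maximum rank of a code. The set of ranks contains `0` and is bounded above by `k`, so the
supremum is a maximum. -/
noncomputable def maxRank (C : DelsarteCode F k m) : ℕ :=
  sSup {d : ℕ | ∃ M ∈ C, M.rank = d}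

/-- A Delsarte optimal anticode (for `k ≤ m`): a code attaining the general upper bound
`dim A ≤ m * maxRank A`. -/
def IsOptimalAnticode (A : DelsarteCode F k m) : Prop :=
  Module.finrank F A = m * A.maxRank

/-- The `r`-th Delsarte generalized weight of a code (for `k ≤ m` and `1 ≤ r ≤ dim C`), as a
rational number: `1 / m` times the smallest dimension of an optimal anticode `A` with
`dim (A ∩ C) ≥ r`. For these `r` the whole matrix space is such an `A`, so the infimum is a
minimum. -/
noncomputable def genWeight (C : DelsarteCode F k m) (r : ℕ) : ℚ :=
  (1 / (m : ℚ)) *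
    ((sInf {d : ℕ | ∃ A : DelsarteCode F k m, A.IsOptimalAnticode ∧
        r ≤ Module.finrank F (A ⊓ C : DelsarteCode F k m) ∧ Module.finrank F A = d} : ℕ) : ℚ)

end DelsarteCode

/-! Since an optimal anticode has dimension `m` times its maximum rank, `genWeight C r` is the least
maximum rank of an optimal anticode meeting `C` in dimension at least `r`. The second, third and
sixth items follow at once; the first uses the optimal anticode of all matrices with columns in the
column space of a given one. The fifth iterates the fourth up to the bound `k`.

The fourth item rests on `IsOptimalAnticode.exists_subcode`: an optimal anticode of maximum rank `s
> 0` contains one of maximum rank `s - 1`. The tool is the set of lexicographic leading positions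
(pivots), which has `dim A` elements. Pivots on a common transversal produce an element of at least
that rank, and the grid splits into `m` transversals, whence `dim A ≤ m * maxRank A`. Equality makes
every transversal meet equally many pivots, so the pivots fill whole rows or, if `k = m`, whole
columns. Up to transposition, `s` rows then determine the matrix and are arbitrary; forcing one of
them to vanish lowers the rank. -/

/-! ### Transversals and leading positions. -/

/-- An injection between two types can be chosen with two prescribed values. -/
theorem exists_embedding_eq_eq {α β : Type*} (f : α ↪ β) {a a' : α} {b b' : β}
    (ha : a ≠ a') (hb : b ≠ b') : ∃ g : α ↪ β, g a = b ∧ g a' = b' := by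
  classical
  let f₁ : α ↪ β := f.trans (Equiv.swap (f a) b).toEmbedding
  have h₁ : f₁ a = b := by simp [f₁]
  have h₂ : f₁ a ≠ f₁ a' := fun h => ha (f₁.injective h)
  refine ⟨f₁.trans (Equiv.swap (f₁ a') b').toEmbedding, ?_, ?_⟩
  · rw [h₁] at h₂
    simp only [Function.Embedding.trans_apply, Equiv.coe_toEmbedding, h₁]
    exact Equiv.swap_apply_of_ne_of_ne h₂ hb
  · simp

/-- Vectors with pairwise distinct leading positions are linearly independent. -/
theorem linearIndependent_of_leading {F ι κ : Type*} [Field F] [LinearOrder κ]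
    (v : ι → κ → F) (p : ι → κ) (hp : Function.Injective p)
    (hne : ∀ i, v i (p i) ≠ 0) (hz : ∀ i q, q < p i → v i q = 0) :
    LinearIndependent F v := by
  classical
  rw [linearIndependent_iff']
  intro s g hg
  by_contra! hcon
  obtain ⟨i₀, hi₀, hgi₀⟩ := hcon
  -- At the smallest leading position with non-zero coefficient, only one term of the relation
  -- survives.
  obtain ⟨i, hi, hmin⟩ := (s.filter fun i => g i ≠ 0).exists_min_image p
    ⟨i₀, Finset.mem_filter.2 ⟨hi₀, hgi₀⟩⟩
  rw [Finset.mem_filter] at hi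
  have h := congrFun hg (p i)
  rw [Finset.sum_apply, Finset.sum_eq_single i] at h
  · exact mul_ne_zero hi.2 (hne i) h
  · intro j hj hji
    by_cases hgj : g j = 0
    · simp [hgj]
    · have hle := hmin j (Finset.mem_filter.2 ⟨hj, hgj⟩)
      have hlt : p i < p j := lt_of_le_of_ne hle fun h => hji (hp h).symm
      simp [hz j _ hlt]
  · exact fun h => absurd hi.1 h

/-- A `0`-`1` array in which all injective transversals meet the same number of ones has constant
rows, or it is square with constant columns. -/
theorem constant_rows_or_columns {k m s : ℕ} (hkm : k ≤ m) (S : Finset (Fin k × Fin m))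
    (hS : ∀ σ : Fin k ↪ Fin m, (Finset.univ.filter fun i => (i, σ i) ∈ S).card = s) :
    (∀ i j j', (i, j) ∈ S → (i, j') ∈ S) ∨
      (k = m ∧ ∀ i i' j, (i, j) ∈ S → (i', j) ∈ S) := by
  classical
  let g : Fin k → Fin m → ℤ := fun i j => if (i, j) ∈ S then 1 else 0
  have hg : ∀ σ : Fin k ↪ Fin m, ∑ i, g i (σ i) = s := fun σ => by
    rw [← hS σ]; simp [g]
  have hg1 : ∀ i j, (i, j) ∈ S → g i j = 1 := fun i j h => by simp [g, h]
  have hg0 : ∀ i j, (i, j) ∉ S → g i j = 0 := fun i j h => by simp [g, h]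
  rcases hkm.lt_or_eq with hlt | heq
  · left
    intro i j j' hij
    by_contra hij'
    have hjj : j ≠ j' := by rintro rfl; exact hij' hij
    -- The extra point `none` reserves `j'` as a column unused by `σ`, so swapping `j` and `j'`
    -- moves row `i` only.
    obtain ⟨f⟩ : Nonempty (Option (Fin k) ↪ Fin m) :=
      Function.Embedding.nonempty_of_card_le (by simpa using hlt)
    obtain ⟨f, hf, hf'⟩ := exists_embedding_eq_eq f (a := some i) (a' := none) (by simp) hjj
    let σ : Fin k ↪ Fin m := Function.Embedding.some.trans f
    let τ : Fin k ↪ Fin m := σ.trans (Equiv.swap j j').toEmbedding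
    have hσ : σ i = j := hf
    have hτ : τ i = j' := by simp [τ, hσ]
    have key : ∑ l, (g l (σ l) - g l (τ l)) = g i j - g i j' := by
      rw [Finset.sum_eq_single i, hσ, hτ]
      · intro l _ hl
        have h1 : σ l ≠ j := fun h => hl (σ.injective (h.trans hσ.symm))
        have h2 : σ l ≠ j' := fun h => by
          have := f.injective (a₁ := some l) (a₂ := none) (h.trans hf'.symm)
          simp at this
        simp [τ, Equiv.swap_apply_of_ne_of_ne h1 h2]
      · simp
    rw [Finset.sum_sub_distrib, hg, hg, hg1 _ _ hij, hg0 _ _ hij'] at key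
    omega
  -- In a square array the swap exchanges the columns of two rows, so all 2 × 2 minors vanish
  -- additively: any two rows differ by a constant.
  · have key : ∀ i i' j j', g i j + g i' j' = g i j' + g i' j := by
      intro i i' j j'
      by_cases hii : i = i'
      · subst hii; ring
      by_cases hjj : j = j'
      · subst hjj; ring
      obtain ⟨σ, h1, h2⟩ := exists_embedding_eq_eq (Fin.castLEEmb hkm) hii hjj
      let τ : Fin k ↪ Fin m := σ.trans (Equiv.swap j j').toEmbedding
      have hτ1 : τ i = j' := by simp [τ, h1]
      have hτ2 : τ i' = j := by simp [τ, h2]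
      have h : ∑ l, (g l (σ l) - g l (τ l)) = ∑ l ∈ {i, i'}, (g l (σ l) - g l (τ l)) := by
        symm
        apply Finset.sum_subset (Finset.subset_univ _)
        intro l _ hl
        simp only [Finset.mem_insert, Finset.mem_singleton, not_or] at hl
        have h3 : σ l ≠ j := fun h => hl.1 (σ.injective (h.trans h1.symm))
        have h4 : σ l ≠ j' := fun h => hl.2 (σ.injective (h.trans h2.symm))
        simp [τ, Equiv.swap_apply_of_ne_of_ne h3 h4]
      rw [Finset.sum_sub_distrib, hg, hg, Finset.sum_pair hii, h1, h2, hτ1, hτ2] at h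
      linarith
    by_cases hrow : ∀ i j j', (i, j) ∈ S → (i, j') ∈ S
    · exact Or.inl hrow
    · right
      refine ⟨heq, ?_⟩
      push Not at hrow
      obtain ⟨i, j, j', hij, hij'⟩ := hrow
      -- Row `i` contains both a 0 and a 1, so any constant added to it must be 0.
      have hcol : ∀ i' l, (i', l) ∈ S ↔ (i, l) ∈ S := by
        intro i' l
        have e1 := key i i' j j'
        have e2 := key i i' l j'
        have e3 := key i i' l j
        simp only [g, hij, hij', if_true, if_false] at e1 e2 e3
        split_ifs at e1 e2 e3 <;> first | omega | tauto
      intro a b l hal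
      exact (hcol b l).2 ((hcol a l).1 hal)

/-! ### Rank and independent rows. -/

theorem Matrix.card_le_rank_of_linearIndepOn {F : Type*} [Field F] {k m : ℕ}
    {M : Matrix (Fin k) (Fin m) F} {T : Finset (Fin k)}
    (h : LinearIndepOn F (fun i => M i) (T : Set (Fin k))) : T.card ≤ M.rank := by
  rw [Matrix.rank_eq_finrank_span_row, ← Fintype.card_coe T]
  have h1 := finrank_span_eq_card (R := F) (b := fun i : T => M i) h
  rw [← h1]
  apply Submodule.finrank_mono
  apply Submodule.span_mono
  rintro _ ⟨i, rfl⟩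
  exact ⟨i, rfl⟩

theorem Matrix.eq_zero_of_rank_eq_zero {F : Type*} [Field F] {k m : ℕ}
    {M : Matrix (Fin k) (Fin m) F} (h : M.rank = 0) : M = 0 := by
  rw [Matrix.rank_eq_finrank_span_row, Submodule.finrank_eq_zero, Submodule.span_eq_bot] at h
  ext i j
  exact congrFun (h _ ⟨i, rfl⟩) j

theorem Matrix.row_mem_span_of_linearIndepOn {F : Type*} [Field F] {k m : ℕ}
    {M : Matrix (Fin k) (Fin m) F} {T : Finset (Fin k)}
    (h : LinearIndepOn F (fun i => M i) (T : Set (Fin k))) (hr : M.rank ≤ T.card) (j : Fin k) :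
    M j ∈ Submodule.span F ((fun i => M i) '' (T : Set (Fin k))) := by
  classical
  by_contra hj
  have hjT : j ∉ T := fun hjT => hj (Submodule.subset_span ⟨j, hjT, rfl⟩)
  have h2 : LinearIndepOn F (fun i => M i) ((insert j T : Finset (Fin k)) : Set (Fin k)) := by
    rw [Finset.coe_insert]
    exact h.insert hj
  have := Matrix.card_le_rank_of_linearIndepOn h2
  rw [Finset.card_insert_of_notMem hjT] at this
  omega

/-- A linearly independent pair extends to a linearly independent family of `k ≤ m` vectors,
placed at two prescribed indices. -/
theorem exists_linearIndependent_eq_eq {F : Type*} [Field F] {k m : ℕ} (hkm : k ≤ m)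
    {w z : Fin m → F} (h : LinearIndependent F ![w, z]) {a b : Fin k} (hab : a ≠ b) :
    ∃ v : Fin k → Fin m → F, LinearIndependent F v ∧ v a = w ∧ v b = z := by
  classical
  have hs : LinearIndepOn F id (Set.range ![w, z]) := h.linearIndepOn_id
  let B := Module.Basis.extend hs
  have hsub : Set.range ![w, z] ⊆ hs.extend (Set.subset_univ _) := hs.subset_extend _
  have hw : w ∈ hs.extend (Set.subset_univ _) := hsub ⟨0, rfl⟩
  have hz : z ∈ hs.extend (Set.subset_univ _) := hsub ⟨1, rfl⟩
  have : Fintype (hs.extend (Set.subset_univ _)) := FiniteDimensional.fintypeBasisIndex B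
  have hcard : Fintype.card (hs.extend (Set.subset_univ _)) = m := by
    rw [← Module.finrank_eq_card_basis B, Module.finrank_fin_fun]
  obtain ⟨f⟩ : Nonempty (Fin k ↪ hs.extend (Set.subset_univ _)) :=
    Function.Embedding.nonempty_of_card_le (by rw [hcard]; simpa using hkm)
  have hwz : w ≠ z := by
    have := h.injective.ne (show (0 : Fin 2) ≠ 1 by decide)
    simpa using this
  obtain ⟨f, h1, h2⟩ := exists_embedding_eq_eq f hab (b := ⟨w, hw⟩) (b' := ⟨z, hz⟩)
    (fun h => hwz (congrArg Subtype.val h))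
  refine ⟨fun i => B (f i), B.linearIndependent.comp f f.injective, ?_, ?_⟩
  · simp [B, h1]
  · simp [B, h2]

/-! ### Pivots and the anticode bound. -/

namespace DelsarteCode

variable {F : Type*} [Field F] {k m : ℕ}

theorem bddAbove_ranks (A : DelsarteCode F k m) :
    BddAbove {d : ℕ | ∃ M ∈ A, M.rank = d} := by
  refine ⟨k, ?_⟩
  rintro d ⟨M, -, rfl⟩
  simpa using M.rank_le_height

theorem rank_le_maxRank {A : DelsarteCode F k m} {M : Matrix (Fin k) (Fin m) F} (hM : M ∈ A) :
    M.rank ≤ A.maxRank :=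
  le_csSup A.bddAbove_ranks ⟨M, hM, rfl⟩

theorem maxRank_le {A : DelsarteCode F k m} {s : ℕ} (h : ∀ M ∈ A, M.rank ≤ s) :
    A.maxRank ≤ s := by
  refine csSup_le ⟨_, 0, A.zero_mem, rfl⟩ ?_
  rintro d ⟨M, hM, rfl⟩
  exact h M hM

open Classical in
/-- The pivots of a code: the row-lexicographic leading positions of its non-zero elements. -/
noncomputable def pivots (A : DelsarteCode F k m) : Finset (Fin k × Fin m) :=
  Finset.univ.filter fun p =>
    ∃ M ∈ A, (∀ q, toLex q < toLex p → M q.1 q.2 = 0) ∧ M p.1 p.2 ≠ 0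

theorem mem_pivots {A : DelsarteCode F k m} {p : Fin k × Fin m} :
    p ∈ A.pivots ↔ ∃ M ∈ A, (∀ q, toLex q < toLex p → M q.1 q.2 = 0) ∧ M p.1 p.2 ≠ 0 := by
  simp [pivots]

theorem eq_zero_of_pivots {A : DelsarteCode F k m} {M : Matrix (Fin k) (Fin m) F} (hM : M ∈ A)
    (h : ∀ p ∈ A.pivots, M p.1 p.2 = 0) : M = 0 := by
  classical
  by_contra hne
  obtain ⟨i, j, hij⟩ : ∃ i j, M i j ≠ 0 := by
    by_contra! hcon
    exact hne (by ext i j; exact hcon i j)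
  obtain ⟨p, hp, hmin⟩ :=
    (Finset.univ.filter fun p : Fin k × Fin m => M p.1 p.2 ≠ 0).exists_min_image toLex
      ⟨(i, j), by simpa using hij⟩
  rw [Finset.mem_filter] at hp
  refine hp.2 (h p (mem_pivots.2 ⟨M, hM, fun q hq => ?_, hp.2⟩))
  by_contra hq0
  exact absurd (hmin q (by simpa using hq0)) (not_le.2 hq)

/-- Elements with distinct leading positions are independent, and restriction to the pivots is
injective on `A`. -/
theorem card_pivots (A : DelsarteCode F k m) : A.pivots.card = Module.finrank F A := by
  apply le_antisymm
  · have h : ∀ p : A.pivots, ∃ M : A, (∀ q, toLex q < toLex p.1 → M.1 q.1 q.2 = 0) ∧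
        M.1 p.1.1 p.1.2 ≠ 0 := fun p => by
      obtain ⟨M, hM, h⟩ := mem_pivots.1 p.2
      exact ⟨⟨M, hM⟩, h⟩
    choose N hN0 hN1 using h
    let L : A →ₗ[F] (Fin k ×ₗ Fin m → F) :=
      { toFun := fun M q => M.1 (ofLex q).1 (ofLex q).2
        map_add' := fun _ _ => rfl
        map_smul' := fun _ _ => rfl }
    have hind : LinearIndependent F (fun p => L (N p)) :=
      linearIndependent_of_leading _ (fun p : A.pivots => toLex p.1)
        (fun p q h => Subtype.ext (toLex.injective h)) (fun p => hN1 p)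
        (fun p q hq => hN0 p (ofLex q) hq)
    have := (LinearIndependent.of_comp L hind).fintype_card_le_finrank
    simpa using this
  · let L : A →ₗ[F] (A.pivots → F) :=
      { toFun := fun M p => M.1 p.1.1 p.1.2
        map_add' := fun _ _ => rfl
        map_smul' := fun _ _ => rfl }
    have hL : Function.Injective L := by
      rw [← LinearMap.ker_eq_bot, LinearMap.ker_eq_bot']
      intro M hM
      exact Subtype.ext (eq_zero_of_pivots M.2 fun p hp => congrFun hM ⟨p, hp⟩)
    simpa using LinearMap.finrank_le_finrank_of_injective hL

/-- A partial transversal consisting of pivots yields an element of at least that rank. -/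
theorem exists_card_le_rank (A : DelsarteCode F k m) (σ : Fin k ↪ Fin m) (T : Finset (Fin k))
    (hT : ∀ i ∈ T, (i, σ i) ∈ A.pivots) : ∃ M ∈ A, T.card ≤ M.rank := by
  classical
  have h : ∀ i : Fin k, ∃ N ∈ A, i ∈ T →
      (∀ q : Fin k × Fin m, toLex q < toLex (i, σ i) → N q.1 q.2 = 0) ∧ N i (σ i) ≠ 0 := by
    intro i
    by_cases hi : i ∈ T
    · obtain ⟨N, hN, h⟩ := mem_pivots.1 (hT i hi)
      exact ⟨N, hN, fun _ => h⟩
    · exact ⟨0, A.zero_mem, fun h => absurd h hi⟩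
  choose N hNA hN using h
  have hlt : ∀ i ∈ T, ∀ l, l < i → N i l = 0 := fun i hi l hl => by
    ext c
    exact (hN i hi).1 (l, c) (Prod.Lex.toLex_lt_toLex.2 (Or.inl hl))
  -- The first `n` rows are those of an element of `A`, the others those of the chosen elements.
  have key : ∀ n : ℕ, ∃ M ∈ A,
      LinearIndepOn F (fun i : Fin k => if i.1 < n then M i else N i i) (T : Set (Fin k)) := by
    intro n
    induction n with
    | zero =>
      refine ⟨0, A.zero_mem, ?_⟩
      simp only [Nat.not_lt_zero, if_false]
      refine linearIndependent_of_leading (fun i : (T : Set (Fin k)) => N i i) (fun i => σ i)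
        (fun i j h => Subtype.ext (σ.injective h)) (fun i => (hN i i.2).2) fun i q hq => ?_
      exact (hN i i.2).1 (i, q) (Prod.Lex.toLex_lt_toLex.2 (Or.inr ⟨rfl, hq⟩))
    | succ n ih =>
      obtain ⟨M, hM, hind⟩ := ih
      by_cases hn : ∃ j ∈ T, j.1 = n
      · obtain ⟨j, hj, rfl⟩ := hn
        set T' : Set (Fin k) := (T : Set (Fin k)) \ {j} with hT'
        have hTT : (T : Set (Fin k)) = insert j T' := by
          rw [hT', Set.insert_sdiff_singleton, Set.insert_eq_of_mem (by exact_mod_cast hj)]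
        have hjT' : j ∉ T' := by simp [hT']
        rw [hTT] at hind ⊢
        rw [linearIndepOn_insert hjT'] at hind
        simp only [lt_irrefl, if_false] at hind
        set W := Submodule.span F ((fun i : Fin k => if i.1 < j.1 then M i else N i i) '' T')
          with hW
        -- `M j` and `M j + N j j` cannot both lie in `W`, because `N j j` does not: 0 or 1 serves
        -- as `c`.
        obtain ⟨c, hc⟩ : ∃ c : F, M j + c • N j j ∉ W := by
          by_contra! hcon
          have h0 := hcon 0
          have h1 := hcon 1
          simp only [zero_smul, add_zero, one_smul] at h0 h1
          exact hind.2 ((Submodule.add_mem_iff_right W h0).1 h1)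
        -- `N j` vanishes above row `j`, so the rows already fixed are unchanged.
        have heq : ∀ i ∈ T', (if i.1 < j.1 + 1 then (M + c • N j) i else N i i) =
            if i.1 < j.1 then M i else N i i := by
          intro i hi
          have hne : i.1 ≠ j.1 := fun h => hjT' (Fin.ext h ▸ hi)
          by_cases hij : i.1 < j.1
          · rw [if_pos (by omega), if_pos hij]
            have h0 := hlt j hj i hij
            ext l
            have h0l : N j i l = 0 := congrFun h0 l
            change M i l + c * N j i l = M i l
            rw [h0l, mul_zero, add_zero]
          · rw [if_neg (by omega), if_neg hij]
        refine ⟨M + c • N j, A.add_mem hM (A.smul_mem c (hNA j)), ?_⟩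
        rw [linearIndepOn_insert hjT', linearIndepOn_congr heq, Set.image_congr heq]
        refine ⟨hind.1, ?_⟩
        rw [if_pos (by omega)]
        exact hc
      · refine ⟨M, hM, ?_⟩
        refine (linearIndepOn_congr fun i hi => ?_).1 hind
        have hne : i.1 ≠ n := fun h => hn ⟨i, hi, h⟩
        by_cases hi' : i.1 < n
        · simp only [if_pos hi', if_pos (Nat.lt_succ_of_lt hi')]
        · rw [if_neg hi', if_neg (by omega)]
  obtain ⟨M, hM, h⟩ := key k
  refine ⟨M, hM, Matrix.card_le_rank_of_linearIndepOn ?_⟩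
  simpa using h

open Classical in
theorem card_pivots_transversal_le (A : DelsarteCode F k m) (σ : Fin k ↪ Fin m) :
    (Finset.univ.filter fun i => (i, σ i) ∈ A.pivots).card ≤ A.maxRank := by
  obtain ⟨M, hM, h⟩ := A.exists_card_le_rank σ
    (Finset.univ.filter fun i => (i, σ i) ∈ A.pivots) (by simp)
  exact h.trans (rank_le_maxRank hM)

-- The cyclic shifts of a transversal partition the grid: in each row, `c + σ i` runs once through
-- all columns.
open Classical in
theorem sum_card_pivots_shift [NeZero m] (A : DelsarteCode F k m) (σ : Fin k ↪ Fin m) :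
    ∑ c : Fin m, (Finset.univ.filter fun i =>
      (i, σ.trans (Equiv.addLeft c).toEmbedding i) ∈ A.pivots).card = Module.finrank F A := by
  rw [← card_pivots]
  simp only [Finset.card_filter]
  rw [Finset.sum_comm]
  have h : ∀ i : Fin k, (∑ c : Fin m,
      if (i, σ.trans (Equiv.addLeft c).toEmbedding i) ∈ A.pivots then 1 else 0) =
      ∑ j : Fin m, if (i, j) ∈ A.pivots then 1 else 0 := fun i =>
    Equiv.sum_comp (Equiv.addRight (σ i)) (fun j => if (i, j) ∈ A.pivots then 1 else 0)
  rw [Finset.sum_congr rfl fun i _ => h i, ← Finset.sum_product', Finset.univ_product_univ,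
    ← Finset.card_filter]
  simp

/-- The anticode bound. -/
theorem finrank_le_mul_maxRank (hkm : k ≤ m) (A : DelsarteCode F k m) :
    Module.finrank F A ≤ m * A.maxRank := by
  classical
  rcases Nat.eq_zero_or_pos m with rfl | hm
  · rw [← card_pivots, Finset.card_eq_zero.2 (Finset.eq_empty_of_isEmpty _)]
    exact Nat.zero_le _
  have : NeZero m := ⟨hm.ne'⟩
  rw [← A.sum_card_pivots_shift (Fin.castLEEmb hkm)]
  refine (Finset.sum_le_sum fun c _ => A.card_pivots_transversal_le _).trans ?_
  simp

theorem IsOptimalAnticode.card_pivots_transversal (hkm : k ≤ m) {A : DelsarteCode F k m}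
    (hA : A.IsOptimalAnticode) (σ : Fin k ↪ Fin m) [DecidablePred fun i => (i, σ i) ∈ A.pivots] :
    (Finset.univ.filter fun i => (i, σ i) ∈ A.pivots).card = A.maxRank := by
  classical
  rcases Nat.eq_zero_or_pos m with rfl | hm
  · obtain rfl : k = 0 := by omega
    have : A.maxRank ≤ 0 := maxRank_le fun M _ => by simpa using M.rank_le_height
    have h2 : (Finset.univ.filter fun i => (i, σ i) ∈ A.pivots) = ∅ :=
      Finset.eq_empty_of_isEmpty _
    rw [h2]
    simp; omega
  have : NeZero m := ⟨hm.ne'⟩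
  have hsum := A.sum_card_pivots_shift σ
  have hAeq : Module.finrank F A = m * A.maxRank := hA
  have hconst : ∑ _c : Fin m, A.maxRank = m * A.maxRank := by simp
  rw [hAeq, ← hconst] at hsum
  -- Equality of the sums forces equality in every term; the shift by 0 is `σ` itself.
  have h := (Finset.sum_eq_sum_iff_of_le fun c _ =>
    A.card_pivots_transversal_le (σ.trans (Equiv.addLeft c).toEmbedding)).1 hsum 0
    (Finset.mem_univ _)
  convert h using 3
  simp

/-! ### Structure of optimal anticodes. -/

/-- If a code is determined by some `s` of its rows, these rows are arbitrary, and all its ranks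
are at most `s`, then it has a large subcode with smaller ranks. -/
theorem exists_subcode_of_rows (hkm : k ≤ m) (A : DelsarteCode F k m) (I : Finset (Fin k))
    (hI : I.Nonempty) (hinj : ∀ M ∈ A, (∀ i ∈ I, M i = 0) → M = 0)
    (hdim : Module.finrank F A = m * I.card) (hrk : ∀ M ∈ A, M.rank ≤ I.card) :
    ∃ A' : DelsarteCode F k m, A' ≤ A ∧ Module.finrank F A ≤ Module.finrank F A' + m ∧
      ∀ M ∈ A', M.rank < I.card := by
  classical
  let L : A →ₗ[F] (I → Fin m → F) :=
    { toFun := fun M i => M.1 i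
      map_add' := fun _ _ => rfl
      map_smul' := fun _ _ => rfl }
  have hL : Function.Injective L := by
    rw [← LinearMap.ker_eq_bot, LinearMap.ker_eq_bot']
    intro M hM
    exact Subtype.ext (hinj M.1 M.2 fun i hi => congrFun hM ⟨i, hi⟩)
  have hfin : Module.finrank F A = Module.finrank F (I → Fin m → F) := by
    rw [hdim, Module.finrank_pi_fintype]
    simp [mul_comm]
  let e : A ≃ₗ[F] (I → Fin m → F) := LinearEquiv.ofInjectiveOfFinrankEq L hL hfin
  have heL : ∀ P : I → Fin m → F, ∀ i : I, (e.symm P).1 i = P i := fun P i =>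
    congrFun (e.apply_symm_apply P) i
  -- Independent rows in `I` already exhaust the maximal rank, so they span all the other rows.
  have hspan : ∀ P : I → Fin m → F, LinearIndependent F P → ∀ j,
      (e.symm P).1 j ∈ Submodule.span F (Set.range P) := by
    intro P hP j
    have h1 : LinearIndepOn F (fun i => (e.symm P).1 i) (I : Set (Fin k)) := by
      change LinearIndependent F (fun i : I => (e.symm P).1 i)
      simpa only [heL] using hP
    have h2 := Matrix.row_mem_span_of_linearIndepOn h1 (hrk _ (e.symm P).2) j
    refine Submodule.span_mono ?_ h2
    rintro _ ⟨i, hi, rfl⟩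
    exact ⟨⟨i, hi⟩, (heL P ⟨i, hi⟩).symm⟩
  have hsingle : ∀ (i : I) (w : Fin m → F) (j : Fin k),
      (e.symm (Pi.single i w)).1 j ∈ Submodule.span F {w} := by
    intro i w j
    by_cases hj : j ∈ I
    · rw [heL _ ⟨j, hj⟩]
      by_cases hij : (⟨j, hj⟩ : I) = i
      · rw [hij, Pi.single_eq_same]
        exact Submodule.mem_span_singleton_self w
      · rw [Pi.single_eq_of_ne hij]
        exact Submodule.zero_mem _
    -- If `z` is not a multiple of `w`, take independent rows `P` with `w` at some `i' ≠ i` and `z`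
    -- outside their span. Adding `w` to row `i` keeps the rows independent without enlarging their
    -- span, so subtracting the two lifts puts `z` in that span.
    by_contra hz
    set z := (e.symm (Pi.single i w)).1 j with hzdef
    have hw : w ≠ 0 := by
      rintro rfl
      apply hz
      rw [hzdef, Pi.single_zero, map_zero]
      exact Submodule.zero_mem _
    by_cases hex : ∃ i' : I, i' ≠ i
    · obtain ⟨i', hi'⟩ := hex
      have hpair : LinearIndependent F ![w, z] := by
        rw [LinearIndependent.pair_iff' hw]
        intro a ha
        exact hz (Submodule.mem_span_singleton.2 ⟨a, ha⟩)
      obtain ⟨v, hv, hvw, hvz⟩ := exists_linearIndependent_eq_eq hkm hpair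
        (show i'.1 ≠ j from fun h => hj (h ▸ i'.2))
      let P : I → Fin m → F := fun l => v l
      have hP : LinearIndependent F P := hv.comp Subtype.val Subtype.val_injective
      have hQ : LinearIndependent F (P + Pi.single i w) := by
        have h := (linearIndependent_add_smul_iff (v := P) (c := Pi.single i 1) (i := i')
          (Pi.single_eq_of_ne hi' _)).2 hP
        have heq : (fun l => (Pi.single i 1 : I → F) l • P i') = Pi.single i w := by
          ext l : 1
          by_cases hl : l = i
          · subst hl; simp [P, hvw]
          · simp [hl]
        rwa [heq] at h
      have hsub : Submodule.span F (Set.range (P + Pi.single i w)) ≤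
          Submodule.span F (Set.range P) := by
        rw [Submodule.span_le]
        rintro _ ⟨l, rfl⟩
        refine Submodule.add_mem _ (Submodule.subset_span ⟨l, rfl⟩) ?_
        by_cases hl : l = i
        · subst hl
          rw [Pi.single_eq_same]
          exact Submodule.subset_span ⟨i', hvw⟩
        · rw [Pi.single_eq_of_ne hl]
          exact Submodule.zero_mem _
      have h1 := hspan P hP j
      have h2 := hsub (hspan _ hQ j)
      rw [map_add] at h2
      have h3 : z ∈ Submodule.span F (Set.range P) := (Submodule.add_mem_iff_right _ h1).1 h2
      have h4 := hv.notMem_span_image (s := (I : Set (Fin k))) (x := j) (by simpa using hj)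
      apply h4
      rw [hvz]
      refine Submodule.span_mono ?_ h3
      rintro _ ⟨l, rfl⟩
      exact ⟨l, l.2, rfl⟩
    · push Not at hex
      have : Unique I := ⟨⟨i⟩, hex⟩
      have h := hspan (Pi.single i w) (by
        apply LinearIndependent.of_subsingleton i
        simpa using hw) j
      apply hz
      refine Submodule.span_mono ?_ h
      rintro _ ⟨l, rfl⟩
      rw [hex l]
      simp
  obtain ⟨i₀, hi₀⟩ := hI
  -- The subcode is cut out by row `i₀ = 0`. By `hsingle` and linearity, all its rows lie in the
  -- span of the rows in `I` other than `i₀`.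
  let R : A →ₗ[F] (Fin m → F) := (LinearMap.proj (⟨i₀, hi₀⟩ : I)).comp L
  refine ⟨(LinearMap.ker R).map A.subtype, Submodule.map_subtype_le _ _, ?_, ?_⟩
  · have h1 := R.finrank_range_add_finrank_ker
    have h2 : Module.finrank F (LinearMap.range R) ≤ m := by
      simpa using Submodule.finrank_le (LinearMap.range R)
    rw [Submodule.finrank_map_subtype_eq]
    omega
  · rintro _ ⟨M, hM, rfl⟩
    have hM0 : M.1 i₀ = 0 := hM
    have hrow : ∀ j, M.1 j ∈ Submodule.span F (((I.erase i₀).image fun i => M.1 i :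
        Finset (Fin m → F)) : Set (Fin m → F)) := by
      intro j
      have h1 : M = ∑ i : I, e.symm (Pi.single i (e M i)) := by
        rw [← map_sum, Finset.univ_sum_single, e.symm_apply_apply]
      have h2 : M.1 j = ∑ i : I, (e.symm (Pi.single i (e M i))).1 j := by
        let row : A →ₗ[F] (Fin m → F) :=
          { toFun := fun M => M.1 j
            map_add' := fun _ _ => rfl
            map_smul' := fun _ _ => rfl }
        exact (congrArg row h1).trans (map_sum row _ _)
      rw [h2]
      refine Submodule.sum_mem _ fun i _ => ?_
      have h3 := hsingle i (e M i) j
      have h4 : e M i = M.1 i := rfl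
      by_cases hi : i.1 = i₀
      · rw [h4, hi, hM0, Submodule.span_zero_singleton, Submodule.mem_bot] at h3
        rw [h4, hi, hM0, h3]
        exact Submodule.zero_mem _
      · refine Submodule.span_mono ?_ h3
        rw [Set.singleton_subset_iff, h4]
        exact Finset.mem_coe.2 (Finset.mem_image_of_mem _ (Finset.mem_erase.2 ⟨hi, i.2⟩))
    have hle : M.1.rank ≤ (I.erase i₀).card := by
      rw [Matrix.rank_eq_finrank_span_row]
      refine le_trans (Submodule.finrank_mono ?_)
        ((finrank_span_finset_le_card ((I.erase i₀).image fun i => M.1 i)).trans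
          Finset.card_image_le)
      rw [Submodule.span_le]
      rintro _ ⟨j, rfl⟩
      exact hrow j
    exact hle.trans_lt (Finset.card_erase_lt_of_mem hi₀)

/-- A non-trivial optimal anticode has a subcode of codimension at most `m` with smaller ranks. -/
theorem IsOptimalAnticode.exists_subcode (hkm : k ≤ m) {A : DelsarteCode F k m}
    (hA : A.IsOptimalAnticode) (hpos : 0 < A.maxRank) :
    ∃ A' : DelsarteCode F k m, A' ≤ A ∧ Module.finrank F A ≤ Module.finrank F A' + m ∧
      ∀ M ∈ A', M.rank < A.maxRank := by
  classical
  have htr := fun σ => hA.card_pivots_transversal hkm σ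
  have hAeq : Module.finrank F A = m * A.maxRank := hA
  rcases constant_rows_or_columns hkm A.pivots htr with hrow | ⟨rfl, hcol⟩
  · set I := Finset.univ.filter fun i => (i, Fin.castLEEmb hkm i) ∈ A.pivots with hI
    have hcard : I.card = A.maxRank := htr _
    rw [← hcard] at hAeq hpos ⊢
    refine exists_subcode_of_rows hkm A I (Finset.card_pos.1 hpos) ?_ hAeq
      fun M hM => hcard ▸ rank_le_maxRank hM
    intro M hM h0
    refine eq_zero_of_pivots hM fun p hp => ?_
    exact congrFun (h0 p.1 (Finset.mem_filter.2 ⟨Finset.mem_univ _, hrow _ _ _ hp⟩)) p.2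
  · set J := Finset.univ.filter fun j => (j, j) ∈ A.pivots with hJ
    have hcard : J.card = A.maxRank := htr (Function.Embedding.refl _)
    -- The pivots of the transposed code are not needed: vanishing on the old pivots still forces a
    -- matrix to be zero.
    let T := Matrix.transposeLinearEquiv (Fin k) (Fin k) F F
    have hT : ∀ M ∈ A.map T.toLinearMap, M.transpose ∈ A := by
      rintro _ ⟨M, hM, rfl⟩
      simpa [T] using hM
    rw [← hcard] at hAeq hpos ⊢
    obtain ⟨B, hB, hdim, hrk⟩ := exists_subcode_of_rows le_rfl (A.map T.toLinearMap) J
      (Finset.card_pos.1 hpos) (fun M hM h0 => by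
        have h := eq_zero_of_pivots (hT M hM) fun p hp =>
          congrFun (h0 p.2 (Finset.mem_filter.2 ⟨Finset.mem_univ _, hcol _ _ _ hp⟩)) p.1
        simpa using h)
      ((T.finrank_map_eq A).trans hAeq)
      (fun M hM => by
        rw [← Matrix.rank_transpose, hcard]
        exact rank_le_maxRank (hT M hM))
    refine ⟨B.map T.toLinearMap, ?_, ?_, ?_⟩
    · rintro _ ⟨M, hM, rfl⟩
      exact hT M (hB hM)
    · have h1 := T.finrank_map_eq A
      have h2 := T.finrank_map_eq B
      exact (h1.symm.le.trans hdim).trans_eq (congrArg (· + k) h2.symm)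
    · rintro _ ⟨M, hM, rfl⟩
      change M.transpose.rank < _
      rw [Matrix.rank_transpose]
      exact hrk M hM

/-- A code with large dimension and small ranks is an optimal anticode. -/
theorem isOptimalAnticode_of_le (hm : 0 < m) (hkm : k ≤ m) {A : DelsarteCode F k m} {s : ℕ}
    (hdim : m * s ≤ Module.finrank F A) (hrk : ∀ M ∈ A, M.rank ≤ s) :
    A.IsOptimalAnticode ∧ A.maxRank = s := by
  have h1 := A.finrank_le_mul_maxRank hkm
  have h2 : A.maxRank ≤ s := maxRank_le hrk
  have h3 : s ≤ A.maxRank := Nat.le_of_mul_le_mul_left (hdim.trans h1) hm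
  have h4 : A.maxRank = s := le_antisymm h2 h3
  refine ⟨?_, h4⟩
  rw [IsOptimalAnticode]
  exact le_antisymm h1 (by rwa [h4])

theorem isOptimalAnticode_top (hm : 0 < m) (hkm : k ≤ m) :
    (⊤ : DelsarteCode F k m).IsOptimalAnticode ∧ (⊤ : DelsarteCode F k m).maxRank = k := by
  refine isOptimalAnticode_of_le hm hkm ?_ fun M _ => by simpa using M.rank_le_height
  rw [finrank_top, Module.finrank_matrix]
  simp [mul_comm]

/-- Every matrix lies in an optimal anticode of the same maximum rank. -/
theorem exists_isOptimalAnticode_mem (hm : 0 < m) (hkm : k ≤ m) (M : Matrix (Fin k) (Fin m) F) :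
    ∃ A : DelsarteCode F k m, A.IsOptimalAnticode ∧ A.maxRank = M.rank ∧ M ∈ A := by
  let U : Submodule F (Fin k → F) := Submodule.span F (Set.range M.col)
  have hU : Module.finrank F U = M.rank := M.rank_eq_finrank_span_cols.symm
  -- The `m` columns range freely over `U`, so the dimension is `m * M.rank`.
  let A : DelsarteCode F k m :=
    { carrier := {N | ∀ j, N.col j ∈ U}
      add_mem' := fun ha hb j => U.add_mem (ha j) (hb j)
      zero_mem' := fun _ => U.zero_mem
      smul_mem' := fun c _ ha j => U.smul_mem c (ha j) }
  let L : (Fin m → U) →ₗ[F] A :=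
    { toFun := fun c => ⟨Matrix.of fun i j => (c j).1 i, fun j => (c j).2⟩
      map_add' := fun _ _ => rfl
      map_smul' := fun _ _ => rfl }
  have hL : Function.Injective L := by
    intro c d h
    ext j i
    exact congrFun (congrFun (congrArg Subtype.val h) i) j
  obtain ⟨h1, h2⟩ := isOptimalAnticode_of_le hm hkm (A := A) (s := M.rank)
    (by
      have := LinearMap.finrank_le_finrank_of_injective hL
      rw [Module.finrank_pi_fintype] at this
      simpa [hU] using this)
    (fun N hN => by
      rw [N.rank_eq_finrank_span_cols, ← hU]
      apply Submodule.finrank_mono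
      rw [Submodule.span_le]
      rintro _ ⟨j, rfl⟩
      exact hN j)
  exact ⟨A, h1, h2, fun j => Submodule.subset_span ⟨j, rfl⟩⟩

/-! ### Generalized weights. -/

/-- The generalized weight is the least maximum rank of an optimal anticode meeting the code in
dimension at least `r`. -/
theorem genWeight_spec (hm : 0 < m) (hkm : k ≤ m) (C : DelsarteCode F k m) {r : ℕ}
    (hr : r ≤ Module.finrank F C) :
    (∃ A : DelsarteCode F k m, A.IsOptimalAnticode ∧
      r ≤ Module.finrank F (A ⊓ C : DelsarteCode F k m) ∧ C.genWeight r = A.maxRank) ∧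
    ∀ B : DelsarteCode F k m, B.IsOptimalAnticode →
      r ≤ Module.finrank F (B ⊓ C : DelsarteCode F k m) → C.genWeight r ≤ B.maxRank := by
  have hm' : (0 : ℚ) < m := by exact_mod_cast hm
  have hval : ∀ B : DelsarteCode F k m, B.IsOptimalAnticode →
      (1 / (m : ℚ)) * (Module.finrank F B : ℚ) = B.maxRank := by
    intro B hB
    have h : Module.finrank F B = m * B.maxRank := hB
    rw [h]
    push_cast
    field_simp
  constructor
  · obtain ⟨A, hA, hAr, hAd⟩ := Nat.sInf_mem (s := {d : ℕ | ∃ A : DelsarteCode F k m,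
      A.IsOptimalAnticode ∧ r ≤ Module.finrank F (A ⊓ C : DelsarteCode F k m) ∧
        Module.finrank F A = d}) ⟨_, ⊤, (isOptimalAnticode_top hm hkm).1, by rwa [top_inf_eq], rfl⟩
    refine ⟨A, hA, hAr, ?_⟩
    rw [← hval A hA, hAd]
    rfl
  · intro B hB hBr
    rw [← hval B hB]
    refine mul_le_mul_of_nonneg_left (Nat.cast_le.2 (Nat.sInf_le ?_)) (by positivity)
    exact ⟨B, hB, hBr, rfl⟩

theorem genWeight_one (hm : 0 < m) (hkm : k ≤ m) (C : DelsarteCode F k m) (hC : C ≠ ⊥) :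
    C.genWeight 1 = C.minRank := by
  have hrank : ∀ M : Matrix (Fin k) (Fin m) F, M ≠ 0 → 0 < M.rank := fun M hM =>
    Nat.pos_of_ne_zero fun h => hM (Matrix.eq_zero_of_rank_eq_zero h)
  have hfin : 1 ≤ Module.finrank F C := Submodule.one_le_finrank_iff.2 hC
  obtain ⟨⟨A, hA, hAr, hAw⟩, hle⟩ := C.genWeight_spec hm hkm hfin
  apply le_antisymm
  · obtain ⟨M, hM, hM0⟩ := C.exists_mem_ne_zero_of_ne_bot hC
    obtain ⟨N, hN, hN0, hNd⟩ := Nat.sInf_mem (s := {d : ℕ | ∃ M ∈ C, 0 < M.rank ∧ M.rank = d})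
      ⟨_, M, hM, hrank M hM0, rfl⟩
    obtain ⟨B, hB, hBN, hNB⟩ := exists_isOptimalAnticode_mem hm hkm N
    have h := hle B hB (Submodule.one_le_finrank_iff.2 fun h => by
      have h0 : N ∈ (B ⊓ C : DelsarteCode F k m) := ⟨hNB, hN⟩
      rw [h, Submodule.mem_bot] at h0
      simp [h0] at hN0)
    rw [hBN, hNd] at h
    exact h
  · obtain ⟨M, hM, hM0⟩ := Submodule.exists_mem_ne_zero_of_ne_bot
      (Submodule.one_le_finrank_iff.1 hAr)
    rw [hAw]
    have h1 : C.minRank ≤ M.rank := Nat.sInf_le ⟨M, hM.2, hrank M hM0, rfl⟩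
    exact_mod_cast h1.trans (rank_le_maxRank hM.1)

theorem genWeight_le (hm : 0 < m) (hkm : k ≤ m) (C : DelsarteCode F k m) {r : ℕ}
    (hr : r ≤ Module.finrank F C) : C.genWeight r ≤ k := by
  obtain ⟨h1, h2⟩ := isOptimalAnticode_top (F := F) hm hkm
  simpa [h2] using (C.genWeight_spec hm hkm hr).2 ⊤ h1 (by rwa [top_inf_eq])

theorem genWeight_mono (hm : 0 < m) (hkm : k ≤ m) (C : DelsarteCode F k m) {r r' : ℕ}
    (h : r ≤ r') (hr : r' ≤ Module.finrank F C) : C.genWeight r ≤ C.genWeight r' := by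
  obtain ⟨A, hA, hAr, hAw⟩ := (C.genWeight_spec hm hkm hr).1
  rw [hAw]
  exact (C.genWeight_spec hm hkm (h.trans hr)).2 A hA (h.trans hAr)

/-- An anticode attaining the weight at `r + m` has a subcode of maximum rank one less; losing at
most `m` dimensions, it still meets `C` in dimension at least `r`. -/
theorem genWeight_add_one_le (hm : 0 < m) (hkm : k ≤ m) (C : DelsarteCode F k m) {r : ℕ}
    (hr : r + m ≤ Module.finrank F C) : C.genWeight r + 1 ≤ C.genWeight (r + m) := by
  obtain ⟨A, hA, hAr, hAw⟩ := (C.genWeight_spec hm hkm hr).1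
  have hAd : Module.finrank F A = m * A.maxRank := hA
  have hpos : 0 < A.maxRank := by
    rcases Nat.eq_zero_or_pos A.maxRank with h | h
    · have := Submodule.finrank_mono (R := F) (inf_le_left : A ⊓ C ≤ A)
      rw [hAd, h] at this
      omega
    · exact h
  obtain ⟨B, hBA, hdim, hrk⟩ := hA.exists_subcode hkm hpos
  obtain ⟨s, hs⟩ : ∃ s, A.maxRank = s + 1 := ⟨A.maxRank - 1, by omega⟩
  obtain ⟨hB, hBs⟩ := isOptimalAnticode_of_le hm hkm (A := B) (s := s)
    (by rw [hAd, hs, mul_add] at hdim; omega)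
    (fun M hM => by have := hrk M hM; omega)
  have hint : r ≤ Module.finrank F (B ⊓ C : DelsarteCode F k m) := by
    have h1 := Submodule.finrank_sup_add_finrank_inf_eq B (A ⊓ C)
    have h2 : Module.finrank F (B ⊔ (A ⊓ C) : DelsarteCode F k m) ≤ Module.finrank F A :=
      Submodule.finrank_mono (sup_le hBA inf_le_left)
    rw [← inf_assoc, inf_eq_left.2 hBA] at h1
    omega
  have h := (C.genWeight_spec hm hkm (by omega)).2 B hB hint
  rw [hAw, hs]
  rw [hBs] at h
  push_cast
  linarith

theorem genWeight_add_le (hm : 0 < m) (hkm : k ≤ m) (C : DelsarteCode F k m) {r : ℕ} (n : ℕ)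
    (hr : r + n * m ≤ Module.finrank F C) : C.genWeight r + n ≤ C.genWeight (r + n * m) := by
  induction n with
  | zero => simp
  | succ n ih =>
    have h : r + (n + 1) * m = r + n * m + m := by ring
    rw [h] at hr ⊢
    have h1 := ih (by omega)
    have h2 := C.genWeight_add_one_le hm hkm hr
    push_cast
    linarith

end DelsarteCode

theorem theorem6p2 {F : Type*} [Field F] [Finite F] (k m t : ℕ) (hk : 1 ≤ k) (hkm : k ≤ m)
    (C : DelsarteCode F k m) (hC : C ≠ ⊥) (ht : Module.finrank F C = t) :
    C.genWeight 1 = (C.minRank : ℚ) ∧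
    C.genWeight t ≤ (k : ℚ) ∧
    (∀ r : ℕ, 1 ≤ r → r + 1 ≤ t → C.genWeight r ≤ C.genWeight (r + 1)) ∧
    (∀ r : ℕ, 1 ≤ r → r + m ≤ t → C.genWeight r < C.genWeight (r + m)) ∧
    (∀ r : ℕ, 1 ≤ r → r ≤ t →
      C.genWeight r ≤ (k : ℚ) - ((⌊((t : ℚ) - (r : ℚ)) / (m : ℚ)⌋ : ℤ) : ℚ)) ∧
    (∀ r : ℕ, 1 ≤ r → r ≤ t →
      ((⌈(r : ℚ) / (m : ℚ)⌉ : ℤ) : ℚ) ≤ C.genWeight r) := by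
  have hm : 0 < m := by omega
  have hm' : (0 : ℚ) < m := by exact_mod_cast hm
  subst ht
  refine ⟨C.genWeight_one hm hkm hC, C.genWeight_le hm hkm le_rfl,
    fun r _ hr => C.genWeight_mono hm hkm r.le_succ hr, fun r _ hr => ?_, fun r _ hr => ?_,
    fun r _ hr => ?_⟩
  · linarith [C.genWeight_add_one_le hm hkm hr]
  -- `n` is the number of steps of length `m` that fit between `r` and `dim C`; each raises the
  -- weight by at least 1, and the last weight is at most `k`.
  · set n := (Module.finrank F C - r) / m with hn
    have hnm : r + n * m ≤ Module.finrank F C := by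
      have := Nat.div_mul_le_self (Module.finrank F C - r) m
      rw [← hn] at this
      omega
    have hfloor : ⌊((Module.finrank F C : ℚ) - (r : ℚ)) / (m : ℚ)⌋ = n := by
      rw [← Nat.cast_sub hr, hn]
      exact Rat.floor_natCast_div_natCast _ _
    rw [hfloor]
    have h1 := C.genWeight_add_le hm hkm n hnm
    have h2 := C.genWeight_le hm hkm hnm
    push_cast
    linarith
  · obtain ⟨A, hA, hAr, hAw⟩ := (C.genWeight_spec hm hkm hr).1
    have hAd : Module.finrank F A = m * A.maxRank := hA
    have h1 : r ≤ m * A.maxRank :=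
      hAd ▸ hAr.trans (Submodule.finrank_mono (inf_le_left : A ⊓ C ≤ A))
    have h2 : ⌈(r : ℚ) / (m : ℚ)⌉ ≤ (A.maxRank : ℤ) := by
      rw [Int.ceil_le, div_le_iff₀ hm']
      rw [mul_comm] at h1
      exact_mod_cast h1
    rw [hAw]
    exact_mod_cast h2
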